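/- Let $\mathbb{K}\in\{\mathbb{R},\mathbb{C}\}$. For $m,n\in\mathbb{N}_0$ let $\mathscr{O}^m_n(\mathbb{R})$ be the space of all $\mathbb{K}$-valued $f\in C^m(\mathbb{R})$ with $$|f|_{m,n}:=\sup_{x\in\mathbb{R},\,0\le j\le m}(1+|x|^2)^{-n}|f^{(j)}(x)|<\infty,$$ normed by $|\cdot|_{m,n}$, let $\mathscr{O}^m(\mathbb{R})=\bigcup_n\mathscr{O}^m_n(\mathbb{R})$ carry the locally convex inductive limit topology of the spaces $\mathscr{O}^m_n(\mathbb{R})$, and let $\mathscr{O}_M(\mathbb{R})=\bigcap_m\mathscr{O}^m(\mathbb{R})$ carry the projective limit topology of the spaces $\mathscr{O}^m(\mathbb{R})$. Let $\psi:\mathbb{R}\to\mathbb{R}$ be a (real-valued) function in $\mathscr{O}_M(\mathbb{R})$ that is bijective, satisfies $\psi'(x)\neq 0$ for every $x\in\mathbb{R}$, and has no fixed points. Let $\psi_0=\mathrm{id}$, $\psi_n=\psi\circ\psi_{n-1}$ and $\psi_{-n}=(\psi_n)^{-1}$ for $n\ge 1$. Suppose that $\{(\psi_n)':n\in\mathbb{Z}\}$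 is a bounded subset of $\mathscr{O}_M(\mathbb{R})$. Then the composition operator $C_\psi:\mathscr{O}_M(\mathbb{R})\to\mathscr{O}_M(\mathbb{R})$, $f\mapsto f\circ\psi$, is 1. sequentially hypercyclic: there is $g\in\mathscr{O}_M(\mathbb{R})$ such that every $f\in\mathscr{O}_M(\mathbb{R})$ is the limit in $\mathscr{O}_M(\mathbb{R})$ of a sequence of elements of the orbit $\{C_\psi^n g:n\ge 0\}$; and 2. mixing: for all non-empty open sets $U,V\subseteq\mathscr{O}_M(\mathbb{R})$ there is $N$ such that $C_\psi^n(U)\cap V\neq\emptyset$ for every $n\ge N$. -/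

import Mathlib

open Filter Topology
open scoped ContDiff

noncomputable section

namespace SlowlyIncreasing

/-- The weighted quantity `(1 + |x|²)⁻ⁿ |f⁽ʲ⁾(x)|`, indexed by `j ≤ m` and `x ∈ ℝ`. -/
def weighted {𝕜 : Type*} [RCLike 𝕜] (m n : ℕ) (f : ℝ → 𝕜) (p : Fin (m + 1) × ℝ) : ℝ :=
  ((1 + |p.2| ^ 2) ^ n)⁻¹ * ‖iteratedDeriv p.1 f p.2‖

theorem weighted_nonneg {𝕜 : Type*} [RCLike 𝕜] (m n : ℕ) (f : ℝ → 𝕜) (p : Fin (m + 1) × ℝ) :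
    0 ≤ weighted m n f p := by
  unfold weighted; positivity

theorem weighted_add_le {𝕜 : Type*} [RCLike 𝕜] {m : ℕ} (n : ℕ) {f g : ℝ → 𝕜}
    (hf : ContDiff ℝ m f) (hg : ContDiff ℝ m g) (p : Fin (m + 1) × ℝ) :
    weighted m n (f + g) p ≤ weighted m n f p + weighted m n g p := by
  have hp : ((p.1 : ℕ) : WithTop ℕ∞) ≤ (m : WithTop ℕ∞) := by
    exact_mod_cast Nat.lt_succ_iff.mp p.1.2
  unfold weighted
  rw [iteratedDeriv_add (hf.of_le hp).contDiffAt (hg.of_le hp).contDiffAt, ← mul_add]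
  exact mul_le_mul_of_nonneg_left (norm_add_le _ _) (by positivity)

theorem weighted_smul {𝕜 : Type*} [RCLike 𝕜] (m n : ℕ) (c : 𝕜) (f : ℝ → 𝕜)
    (p : Fin (m + 1) × ℝ) : weighted m n (c • f) p = ‖c‖ * weighted m n f p := by
  unfold weighted
  rw [iteratedDeriv_const_smul_field, norm_smul]
  ring

theorem weighted_anti {𝕜 : Type*} [RCLike 𝕜] (m : ℕ) {n n' : ℕ} (h : n ≤ n') (f : ℝ → 𝕜)
    (p : Fin (m + 1) × ℝ) : weighted m n' f p ≤ weighted m n f p := by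
  unfold weighted
  have h1 : (1 : ℝ) ≤ 1 + |p.2| ^ 2 := by nlinarith [sq_nonneg |p.2|]
  gcongr

/-- The vector space `𝒪ₙᵐ(ℝ)` of all `f ∈ Cᵐ(ℝ)` with `|f|_{m,n} < ∞`. -/
def stepSubmodule (𝕜 : Type*) [RCLike 𝕜] (m n : ℕ) : Submodule 𝕜 (ℝ → 𝕜) where
  carrier := {f | ContDiff ℝ m f ∧ BddAbove (Set.range (weighted m n f))}
  zero_mem' := by
    refine ⟨contDiff_const, 0, ?_⟩
    rintro _ ⟨p, rfl⟩
    have := weighted_smul m n (0 : 𝕜) 0 p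
    rw [zero_smul, norm_zero, zero_mul] at this
    exact this.le
  add_mem' := by
    rintro f g ⟨hf, A, hA⟩ ⟨hg, B, hB⟩
    refine ⟨hf.add hg, A + B, ?_⟩
    rintro _ ⟨p, rfl⟩
    exact (weighted_add_le n hf hg p).trans (add_le_add (hA ⟨p, rfl⟩) (hB ⟨p, rfl⟩))
  smul_mem' := by
    rintro c f ⟨hf, A, hA⟩
    refine ⟨contDiff_const.smul hf, ‖c‖ * A, ?_⟩
    rintro _ ⟨p, rfl⟩
    rw [weighted_smul]
    exact mul_le_mul_of_nonneg_left (hA ⟨p, rfl⟩) (norm_nonneg _)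

theorem stepSubmodule_mono (𝕜 : Type*) [RCLike 𝕜] (m : ℕ) {n n' : ℕ} (h : n ≤ n') :
    stepSubmodule 𝕜 m n ≤ stepSubmodule 𝕜 m n' := by
  rintro f ⟨hf, A, hA⟩
  refine ⟨hf, A, ?_⟩
  rintro _ ⟨p, rfl⟩
  exact (weighted_anti m h f p).trans (hA ⟨p, rfl⟩)

/-- The vector space `𝒪ᵐ(ℝ) = ⋃ₙ 𝒪ₙᵐ(ℝ)`. -/
def unionSubmodule (𝕜 : Type*) [RCLike 𝕜] (m : ℕ) : Submodule 𝕜 (ℝ → 𝕜) where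
  carrier := ⋃ n : ℕ, (stepSubmodule 𝕜 m n : Set (ℝ → 𝕜))
  zero_mem' := Set.mem_iUnion.mpr ⟨0, Submodule.zero_mem _⟩
  add_mem' := by
    intro f g hf hg
    obtain ⟨n, hn⟩ := Set.mem_iUnion.mp hf
    obtain ⟨k, hk⟩ := Set.mem_iUnion.mp hg
    exact Set.mem_iUnion.mpr ⟨max n k, Submodule.add_mem _
      (stepSubmodule_mono 𝕜 m (le_max_left n k) hn)
      (stepSubmodule_mono 𝕜 m (le_max_right n k) hk)⟩
  smul_mem' := by
    intro c f hf
    obtain ⟨n, hn⟩ := Set.mem_iUnion.mp hf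
    exact Set.mem_iUnion.mpr ⟨n, Submodule.smul_mem _ c hn⟩

/-- The vector space `𝒪_M(ℝ) = ⋂ₘ ⋃ₙ 𝒪ₙᵐ(ℝ)` of slowly increasing smooth functions. -/
def omSubmodule (𝕜 : Type*) [RCLike 𝕜] : Submodule 𝕜 (ℝ → 𝕜) :=
  ⨅ m : ℕ, unionSubmodule 𝕜 m

theorem mem_omSubmodule_iff {𝕜 : Type*} [RCLike 𝕜] {f : ℝ → 𝕜} :
    f ∈ omSubmodule 𝕜 ↔ ∀ m : ℕ, ∃ n : ℕ, f ∈ stepSubmodule 𝕜 m n := by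
  simp only [omSubmodule, Submodule.mem_iInf]
  exact forall_congr' fun m => Set.mem_iUnion

/-- Membership in `𝒪_M(ℝ)` agrees with Mathlib's functions of temperate growth. -/
theorem mem_omSubmodule_iff_hasTemperateGrowth {𝕜 : Type*} [RCLike 𝕜] {f : ℝ → 𝕜} :
    f ∈ omSubmodule 𝕜 ↔ Function.HasTemperateGrowth f := by
  rw [mem_omSubmodule_iff]
  constructor
  · intro h
    refine ⟨contDiff_infty.mpr fun m => (h m).choose_spec.1, fun m => ?_⟩
    obtain ⟨n, -, A, hA⟩ := h m
    refine ⟨2 * n, A, fun x => ?_⟩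
    have h1 : weighted m n f (Fin.last m, x) ≤ A := hA ⟨_, rfl⟩
    have h0 : 0 ≤ A := (weighted_nonneg _ _ _ _).trans h1
    rw [norm_iteratedFDeriv_eq_norm_iteratedDeriv]
    simp only [weighted, Fin.val_last] at h1
    rw [inv_mul_le_iff₀ (by positivity)] at h1
    refine h1.trans ?_
    rw [mul_comm, pow_mul, Real.norm_eq_abs]
    refine mul_le_mul_of_nonneg_left (pow_le_pow_left₀ (by positivity) ?_ n) h0
    nlinarith [abs_nonneg x]
  · intro h m
    obtain ⟨k, C, hC, hb⟩ := h.norm_iteratedFDeriv_le_uniform m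
    refine ⟨k, h.1.of_le (by exact_mod_cast le_top), C * 2 ^ k, ?_⟩
    rintro _ ⟨⟨j, x⟩, rfl⟩
    have h1 := hb j (Nat.lt_succ_iff.mp j.2) x
    rw [norm_iteratedFDeriv_eq_norm_iteratedDeriv] at h1
    simp only [weighted]
    rw [inv_mul_le_iff₀ (by positivity)]
    refine h1.trans ?_
    have h2 : (1 + ‖x‖) ^ k ≤ (2 * (1 + |x| ^ 2)) ^ k := by
      rw [Real.norm_eq_abs]
      exact pow_le_pow_left₀ (by positivity) (by nlinarith [sq_nonneg (|x| - 1)]) k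
    calc C * (1 + ‖x‖) ^ k ≤ C * (2 * (1 + |x| ^ 2)) ^ k := mul_le_mul_of_nonneg_left h2 hC
      _ = (1 + |x| ^ 2) ^ k * (C * 2 ^ k) := by rw [mul_pow]; ring

/-! The three spaces as types of their own, so that they do not carry the topology of pointwise
convergence inherited from `ℝ → 𝕜`. -/

/-- The Banach space `𝒪ₙᵐ(ℝ)`. -/
def Step (𝕜 : Type*) [RCLike 𝕜] (m n : ℕ) : Type _ := ↥(stepSubmodule 𝕜 m n)

/-- The (LB)-space `𝒪ᵐ(ℝ)`. -/
def LB (𝕜 : Type*) [RCLike 𝕜] (m : ℕ) : Type _ := ↥(unionSubmodule 𝕜 m)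

/-- The space `𝒪_M(ℝ)` of `𝕜`-valued slowly increasing smooth functions. -/
def OM (𝕜 : Type*) [RCLike 𝕜] : Type _ := ↥(omSubmodule 𝕜)

section Instances

variable {𝕜 : Type*} [RCLike 𝕜] {m n : ℕ}

instance : AddCommGroup (Step 𝕜 m n) := inferInstanceAs (AddCommGroup ↥(stepSubmodule 𝕜 m n))
instance : Module 𝕜 (Step 𝕜 m n) := inferInstanceAs (Module 𝕜 ↥(stepSubmodule 𝕜 m n))

instance : AddCommGroup (LB 𝕜 m) := inferInstanceAs (AddCommGroup ↥(unionSubmodule 𝕜 m))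
instance : Module 𝕜 (LB 𝕜 m) := inferInstanceAs (Module 𝕜 ↥(unionSubmodule 𝕜 m))

instance : AddCommGroup (OM 𝕜) := inferInstanceAs (AddCommGroup ↥(omSubmodule 𝕜))
instance : Module 𝕜 (OM 𝕜) := inferInstanceAs (Module 𝕜 ↥(omSubmodule 𝕜))

instance : FunLike (OM 𝕜) ℝ 𝕜 where
  coe f := f.1
  coe_injective := Subtype.val_injective

end Instances

/-- The norm `|f|_{m,n} = sup_{x ∈ ℝ, 0 ≤ j ≤ m} (1 + |x|²)⁻ⁿ |f⁽ʲ⁾(x)|` on `𝒪ₙᵐ(ℝ)`. -/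
def stepNorm (𝕜 : Type*) [RCLike 𝕜] (m n : ℕ) : AddGroupNorm (Step 𝕜 m n) where
  toFun f := ⨆ p, weighted m n f.1 p
  map_zero' := by
    have h : ∀ p, weighted m n (0 : ℝ → 𝕜) p = 0 := fun p => by
      have := weighted_smul m n (0 : 𝕜) 0 p
      rwa [zero_smul, norm_zero, zero_mul] at this
    change (⨆ p, weighted m n (0 : ℝ → 𝕜) p) = 0
    simp only [h, ciSup_const]
  add_le' f g := ciSup_le fun p =>
    (weighted_add_le n f.2.1 g.2.1 p).trans (add_le_add (le_ciSup f.2.2 p) (le_ciSup g.2.2 p))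
  neg' f := by
    have h : ∀ p, weighted m n (-f.1) p = weighted m n f.1 p := fun p => by
      have := weighted_smul m n (-1 : 𝕜) f.1 p
      rwa [neg_one_smul, norm_neg, norm_one, one_mul] at this
    change (⨆ p, weighted m n (-f.1) p) = _
    simp only [h]
  eq_zero_of_map_eq_zero' f hf := by
    refine Subtype.ext (funext fun x => ?_)
    have h : weighted m n f.1 (0, x) ≤ 0 := (le_ciSup f.2.2 (0, x)).trans hf.le
    simp only [weighted, Fin.val_zero, iteratedDeriv_zero] at h
    rw [inv_mul_le_iff₀ (by positivity), mul_zero] at h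
    exact norm_le_zero_iff.mp h

instance {𝕜 : Type*} [RCLike 𝕜] {m n : ℕ} : NormedAddCommGroup (Step 𝕜 m n) :=
  (stepNorm 𝕜 m n).toNormedAddCommGroup

/-- The inclusion `𝒪ₙᵐ(ℝ) → 𝒪ᵐ(ℝ)`. -/
def Step.toLB {𝕜 : Type*} [RCLike 𝕜] {m n : ℕ} (f : Step 𝕜 m n) : LB 𝕜 m :=
  ⟨f.1, Set.mem_iUnion.mpr ⟨n, f.2⟩⟩

/-- The inclusion `𝒪_M(ℝ) → 𝒪ᵐ(ℝ)`. -/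
def OM.toLB {𝕜 : Type*} [RCLike 𝕜] (m : ℕ) (f : OM 𝕜) : LB 𝕜 m :=
  ⟨f.1, (Submodule.mem_iInf _).mp f.2 m⟩

instance {𝕜 : Type*} [RCLike 𝕜] {m : ℕ} : Module ℝ (LB 𝕜 m) :=
  inferInstanceAs (Module ℝ ↥(unionSubmodule 𝕜 m))

/-- The topology of the locally convex inductive limit `𝒪ᵐ(ℝ) = ind_{n → ∞} 𝒪ₙᵐ(ℝ)`: the finest
locally convex vector space topology for which every inclusion `𝒪ₙᵐ(ℝ) → 𝒪ᵐ(ℝ)` is continuous.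
(In the order on topologies a finer topology is smaller.) -/
instance {𝕜 : Type*} [RCLike 𝕜] {m : ℕ} : TopologicalSpace (LB 𝕜 m) :=
  sInf {t : TopologicalSpace (LB 𝕜 m) |
    @IsTopologicalAddGroup (LB 𝕜 m) t _ ∧
    @ContinuousSMul 𝕜 (LB 𝕜 m) _ _ t ∧
    @LocallyConvexSpace ℝ (LB 𝕜 m) _ _ _ _ t ∧
    ∀ n : ℕ, @Continuous (Step 𝕜 m n) (LB 𝕜 m) _ t Step.toLB}

/-- The projective limit topology on `𝒪_M(ℝ)`: the coarsest topology for which every inclusion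
`𝒪_M(ℝ) → 𝒪ᵐ(ℝ)` is continuous. -/
instance {𝕜 : Type*} [RCLike 𝕜] : TopologicalSpace (OM 𝕜) :=
  ⨅ m : ℕ, TopologicalSpace.induced (OM.toLB m) inferInstance

/-- The composition operator `C_ψ : 𝒪_M(ℝ) → 𝒪_M(ℝ)`, `f ↦ f ∘ ψ`, with real-valued symbol
`ψ ∈ 𝒪_M(ℝ)`. -/
def compOp (𝕜 : Type*) [RCLike 𝕜] (ψ : OM ℝ) : OM 𝕜 →ₗ[𝕜] OM 𝕜 where
  toFun f := ⟨fun x => f (ψ x), mem_omSubmodule_iff_hasTemperateGrowth.mpr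
    ((mem_omSubmodule_iff_hasTemperateGrowth.mp f.2).comp
      (mem_omSubmodule_iff_hasTemperateGrowth.mp ψ.2))⟩
  map_add' _ _ := rfl
  map_smul' _ _ := rfl

/-- The iterates `ψ_n`, `n ∈ ℤ`, of a bijection `ψ` of `ℝ`: `ψ_0 = id`, `ψ_n = ψ ∘ ψ_{n-1}` and
`ψ_{-n} = (ψ_n)⁻¹` for `n ≥ 1`. -/
def zIter (ψ : ℝ → ℝ) (hψ : Function.Bijective ψ) (n : ℤ) : ℝ → ℝ :=
  ⇑((Equiv.ofBijective ψ hψ : Equiv.Perm ℝ) ^ n)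

/-- `T` is sequentially hypercyclic if some orbit `{Tⁿ g : n ≥ 0}` is sequentially dense, that is,
every vector is the limit of a sequence of elements of the orbit. -/
def SequentiallyHypercyclic {X : Type*} [TopologicalSpace X] (T : X → X) : Prop :=
  ∃ g : X, seqClosure (Set.range fun n : ℕ => T^[n] g) = Set.univ

/-- `T` is (topologically) mixing if for all non-empty open `U`, `V` there is `N` such that
`Tⁿ(U) ∩ V ≠ ∅` for all `n ≥ N`. -/
def Mixing {X : Type*} [TopologicalSpace X] (T : X → X) : Prop :=
  ∀ U V : Set X, IsOpen U → U.Nonempty → IsOpen V → V.Nonempty →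
    ∃ N : ℕ, ∀ n ≥ N, ((T^[n] '' U) ∩ V).Nonempty

/-- A set of functions is bounded in `𝒪_M(ℝ)` if it is contained in `𝒪_M(ℝ)` and, as a subset of
this locally convex space, is absorbed by every neighbourhood of zero. -/
def BoundedInOM (𝕜 : Type*) [RCLike 𝕜] (S : Set (ℝ → 𝕜)) : Prop :=
  ∃ B : Set (OM 𝕜), Bornology.IsVonNBounded 𝕜 B ∧ (fun g : OM 𝕜 => (g : ℝ → 𝕜)) '' B = S

end SlowlyIncreasing

end

namespace SlowlyIncreasing

/-! Write `ψ_z` for the iterates and call smooth functions with compact support test functions.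
Everything rests on one fact, `exists_step_test_comp_zpow`: for a test function `p`, the functions
`p ∘ ψ_z` tend to zero as `|z| → ∞`, for each `m` inside a single step whose weight exponent `K m`
does not depend on `p`. The bound on the derivatives of the iterates and the chain rule
(`GrowthBound.comp`) keep all `p ∘ ψ_z` bounded in one step. A fixed point free homeomorphism of the
line pushes compact sets to infinity (`exists_escape`), so `p ∘ ψ_z` vanishes on a long interval,
and one extra weight then makes the bound small (`GrowthBound.gain`).

Mixing follows for test functions `f ∈ U` and `g ∈ V`: `f + g ∘ ψ_{-n}` tends to `f`, and its image
`f ∘ ψ_n + g` tends to `g`. For hypercyclicity, take test functions `p_i` dense among all test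
functions and put `S = ∑ p_i ∘ ψ_{-n_i}` with rapidly growing `n_i`. Since `K` is common to all
`p_i`, the sum lies in `𝒪_M(ℝ)`, and `S ∘ ψ_{n_l} - p_l`, the sum of `p_i ∘ ψ_{n_l - n_i}` over `i ≠
l`, is bounded by `2 · 2^{-l}` (`exists_orbit_approximating`).

The topologies enter only through two bridges to explicit estimates: a bounded set satisfies uniform
estimates in one step for each `m` (`exists_uniform_growthBound`), and a sequence null in one step
for each `m` converges (`OM.tendsto_of_stepwiseNull`). -/

/-- The estimate `|f⁽ʲ⁾(x)| ≤ A (1 + |x|²)ᵏ` for all `j ≤ m` and `x ∈ ℝ`, that is,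
`|f|_{m,k} ≤ A`. -/
def GrowthBound {𝕜 : Type*} [RCLike 𝕜] (m k : ℕ) (A : ℝ) (f : ℝ → 𝕜) : Prop :=
  ∀ j ≤ m, ∀ x : ℝ, ‖iteratedDeriv j f x‖ ≤ A * (1 + |x| ^ 2) ^ k

/-! ### Calculus of the growth estimates. -/

section GrowthBound

variable {𝕜 : Type*} [RCLike 𝕜] {m k : ℕ} {A B : ℝ} {f g : ℝ → 𝕜}

theorem one_le_weight (x : ℝ) : 1 ≤ 1 + |x| ^ 2 := by nlinarith [sq_nonneg |x|]

theorem GrowthBound.nonneg (hf : GrowthBound m k A f) : 0 ≤ A := by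
  have h := (norm_nonneg _).trans (hf 0 (Nat.zero_le m) 0)
  simpa using h

theorem GrowthBound.mono (hf : GrowthBound m k A f) {m' k' : ℕ} {A' : ℝ} (hm : m' ≤ m)
    (hk : k ≤ k') (hA : A ≤ A') : GrowthBound m' k' A' f := by
  intro j hj x
  have h0 := hf.nonneg
  refine (hf j (hj.trans hm) x).trans ?_
  have h1 := one_le_weight x
  have h2 := h0.trans hA
  gcongr

theorem GrowthBound.add (hf : GrowthBound m k A f) (hg : GrowthBound m k B g)
    (cf : ContDiff ℝ ∞ f) (cg : ContDiff ℝ ∞ g) : GrowthBound m k (A + B) (f + g) := by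
  intro j hj x
  rw [iteratedDeriv_add (cf.of_le (by exact_mod_cast le_top)).contDiffAt
    (cg.of_le (by exact_mod_cast le_top)).contDiffAt, add_mul]
  exact (norm_add_le _ _).trans (add_le_add (hf j hj x) (hg j hj x))

/-- Vanishing on `[-R, R]` turns a bound into a small one, at the price of one weight. -/
theorem GrowthBound.gain {R : ℝ} (hf : GrowthBound m k A f) {ε : ℝ} (hε : 0 ≤ ε) (hR : 0 ≤ R)
    (hA : A ≤ ε * (1 + R ^ 2)) (h0 : ∀ x, |x| ≤ R → f =ᶠ[𝓝 x] 0) :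
    GrowthBound m (k + 1) ε f := by
  intro j hj x
  rcases le_or_gt |x| R with hx | hx
  · rw [(h0 x hx).iteratedDeriv_eq]
    have : iteratedDeriv j (0 : ℝ → 𝕜) x = 0 := by
      have := iteratedDeriv_const_smul_field (n := j) (x := x) (0 : 𝕜) (0 : ℝ → 𝕜)
      rwa [zero_smul, zero_smul] at this
    rw [this, norm_zero]
    positivity
  · refine (hf j hj x).trans ?_
    have h1 : 1 + R ^ 2 ≤ 1 + |x| ^ 2 := by gcongr
    calc A * (1 + |x| ^ 2) ^ k ≤ (ε * (1 + |x| ^ 2)) * (1 + |x| ^ 2) ^ k := by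
          gcongr
          exact hA.trans (by gcongr)
      _ = ε * (1 + |x| ^ 2) ^ (k + 1) := by ring

theorem GrowthBound.weighted_le (hf : GrowthBound m k A f) (p : Fin (m + 1) × ℝ) :
    weighted m k f p ≤ A := by
  unfold weighted
  rw [inv_mul_le_iff₀ (by positivity), mul_comm]
  exact hf p.1 (Nat.lt_succ_iff.mp p.1.2) p.2

theorem GrowthBound.mem_stepSubmodule (hf : GrowthBound m k A f) (cf : ContDiff ℝ ∞ f) :
    f ∈ stepSubmodule 𝕜 m k :=
  ⟨cf.of_le (by exact_mod_cast le_top), A, by rintro _ ⟨p, rfl⟩; exact hf.weighted_le p⟩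

theorem growthBound_of_mem_stepSubmodule (hf : f ∈ stepSubmodule 𝕜 m k) :
    ∃ A, GrowthBound m k A f := by
  obtain ⟨-, A, hA⟩ := hf
  refine ⟨A, fun j hj x => ?_⟩
  have h : weighted m k f (⟨j, Nat.lt_succ_iff.mpr hj⟩, x) ≤ A := hA ⟨_, rfl⟩
  unfold weighted at h
  rwa [inv_mul_le_iff₀ (by positivity), mul_comm] at h

theorem mem_omSubmodule_of_growthBound (cf : ContDiff ℝ ∞ f)
    (h : ∀ m, ∃ k A, GrowthBound m k A f) : f ∈ omSubmodule 𝕜 :=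
  mem_omSubmodule_iff.mpr fun m => by
    obtain ⟨k, A, hA⟩ := h m
    exact ⟨k, hA.mem_stepSubmodule cf⟩

end GrowthBound

/-! ### From estimates to convergence in `𝒪_M(ℝ)`. -/

section Topology

variable {𝕜 : Type*} [RCLike 𝕜]

theorem OM.contDiff (f : OM 𝕜) : ContDiff ℝ ∞ (f : ℝ → 𝕜) :=
  (mem_omSubmodule_iff_hasTemperateGrowth.mp f.2).1

theorem OM.exists_growthBound (f : OM 𝕜) (m : ℕ) : ∃ k A, GrowthBound m k A (f : ℝ → 𝕜) := by
  obtain ⟨k, hk⟩ := mem_omSubmodule_iff.mp f.2 m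
  exact ⟨k, growthBound_of_mem_stepSubmodule hk⟩

instance {m : ℕ} : IsTopologicalAddGroup (LB 𝕜 m) :=
  topologicalAddGroup_sInf fun _ ht => ht.1

theorem Step.continuous_toLB {m n : ℕ} : Continuous (Step.toLB : Step 𝕜 m n → LB 𝕜 m) :=
  continuous_sInf_rng.mpr fun _ ht => ht.2.2.2 n

theorem Step.norm_le {m n : ℕ} {A : ℝ} (f : Step 𝕜 m n) (hf : GrowthBound m n A f.1) :
    ‖f‖ ≤ A :=
  ciSup_le fun p => hf.weighted_le p

/-- A sequence of smooth functions converges to zero in every `𝒪ᵐ(ℝ)`, within one step. -/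
def StepwiseNull (u : ℕ → ℝ → 𝕜) : Prop :=
  ∀ m, ∃ k, ∀ ε > 0, ∀ᶠ n in atTop, GrowthBound m k ε (u n)

theorem StepwiseNull.add {u v : ℕ → ℝ → 𝕜} (hu : StepwiseNull u) (hv : StepwiseNull v)
    (cu : ∀ n, ContDiff ℝ ∞ (u n)) (cv : ∀ n, ContDiff ℝ ∞ (v n)) :
    StepwiseNull fun n => u n + v n := by
  intro m
  obtain ⟨k, hk⟩ := hu m
  obtain ⟨l, hl⟩ := hv m
  refine ⟨max k l, fun ε hε => ?_⟩
  filter_upwards [hk (ε / 2) (half_pos hε), hl (ε / 2) (half_pos hε)] with n h1 h2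
  have h := (h1.mono le_rfl (le_max_left k l) le_rfl).add (h2.mono le_rfl (le_max_right k l) le_rfl)
    (cu n) (cv n)
  rwa [add_halves] at h

/-- The projective limit lets each `m` be treated alone; there the differences tend to zero in the
norm of one step, and the inclusion of a step is continuous. -/
theorem OM.tendsto_of_stepwiseNull {u : ℕ → OM 𝕜} {f : OM 𝕜}
    (h : StepwiseNull fun n => (u n : ℝ → 𝕜) - (f : ℝ → 𝕜)) : Tendsto u atTop (𝓝 f) := by
  rw [nhds_iInf, tendsto_iInf]
  intro m
  rw [nhds_induced, tendsto_comap_iff, ← tendsto_sub_nhds_zero_iff]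
  obtain ⟨k, hk⟩ := h m
  classical
  -- Differences outside the step are replaced by `0`; this affects only finitely many `n`.
  let w : ℕ → Step 𝕜 m k := fun n =>
    if hn : (u n : ℝ → 𝕜) - (f : ℝ → 𝕜) ∈ stepSubmodule 𝕜 m k then ⟨_, hn⟩ else 0
  have hw : Tendsto w atTop (𝓝 0) := by
    rw [Metric.tendsto_atTop']
    intro ε hε
    obtain ⟨N, hN⟩ := eventually_atTop.mp (hk (ε / 2) (half_pos hε))
    refine ⟨N, fun n hn => ?_⟩
    have h1 := hN n hn.le
    have h2 : (u n : ℝ → 𝕜) - (f : ℝ → 𝕜) ∈ stepSubmodule 𝕜 m k :=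
      h1.mem_stepSubmodule ((u n).contDiff.sub f.contDiff)
    rw [dist_zero_right]
    have h3 : w n = ⟨_, h2⟩ := dif_pos h2
    rw [h3]
    exact (Step.norm_le _ h1).trans_lt (half_lt_self hε)
  have h0 := (Step.continuous_toLB (𝕜 := 𝕜) (m := m) (n := k)).tendsto 0 |>.comp hw
  refine Tendsto.congr' ?_ h0
  filter_upwards [hk 1 one_pos] with n h1
  have h2 : (u n : ℝ → 𝕜) - (f : ℝ → 𝕜) ∈ stepSubmodule 𝕜 m k :=
    h1.mem_stepSubmodule ((u n).contDiff.sub f.contDiff)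
  have h3 : w n = ⟨_, h2⟩ := dif_pos h2
  simp only [Function.comp_apply, h3]
  rfl

end Topology

/-! ### Bounded sets of `𝒪_M(ℝ)` and the steps. -/

section Regular

/-- For `n ≥ k` the weight with exponent `n` beats growth of order `k`; the finitely many remaining
points are paid for by the sum in the constant. -/
theorem exists_sampling_bound (m : ℕ) (j : ℕ → Fin (m + 1)) (x : ℕ → ℝ) (k : ℕ) :
    ∃ C : ℝ, ∀ (f : ℝ → ℝ) (A : ℝ), GrowthBound m k A f → ∀ n,
      ‖((1 + |x n| ^ 2) ^ n)⁻¹ * iteratedDeriv (j n) f (x n)‖ ≤ C * A := by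
  refine ⟨1 + ∑ i ∈ Finset.range k, (1 + |x i| ^ 2) ^ k, fun f A hf n => ?_⟩
  have hA := hf.nonneg
  have hs : 0 ≤ ∑ i ∈ Finset.range k, (1 + |x i| ^ 2) ^ k :=
    Finset.sum_nonneg fun i _ => by positivity
  have h1 := one_le_weight (x n)
  rw [norm_mul, norm_inv, Real.norm_of_nonneg (by positivity), inv_mul_le_iff₀ (by positivity)]
  refine (hf (j n) (Nat.lt_succ_iff.mp (j n).2) (x n)).trans ?_
  rw [mul_comm A, ← mul_assoc]
  refine mul_le_mul_of_nonneg_right ?_ hA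
  rcases lt_or_ge n k with hn | hn
  · have h2 : (1 + |x n| ^ 2) ^ k ≤ ∑ i ∈ Finset.range k, (1 + |x i| ^ 2) ^ k :=
      Finset.single_le_sum (f := fun i => (1 + |x i| ^ 2) ^ k) (fun i _ => by positivity)
        (Finset.mem_range.mpr hn)
    have h3 : (1 : ℝ) ≤ (1 + |x n| ^ 2) ^ n := one_le_pow₀ h1
    nlinarith
  · have h2 : (1 + |x n| ^ 2) ^ k ≤ (1 + |x n| ^ 2) ^ n := by gcongr
    have h3 : (0 : ℝ) ≤ (1 + |x n| ^ 2) ^ n := by positivity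
    nlinarith

/-- Weighted evaluations of derivatives along a sequence of points, with weights decaying faster
than every fixed `(1 + |x|²)⁻ᵏ`, as a linear map into the bounded sequences. -/
noncomputable def sampling (m : ℕ) (j : ℕ → Fin (m + 1)) (x : ℕ → ℝ) :
    LB ℝ m →ₗ[ℝ] lp (fun _ : ℕ => ℝ) ⊤ where
  toFun f := ⟨fun n => ((1 + |x n| ^ 2) ^ n)⁻¹ * iteratedDeriv (j n) f.1 (x n), by
    obtain ⟨k, hk⟩ := Set.mem_iUnion.mp f.2
    obtain ⟨A, hA⟩ := growthBound_of_mem_stepSubmodule hk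
    obtain ⟨C, hC⟩ := exists_sampling_bound m j x k
    refine memℓp_infty ⟨C * A, ?_⟩
    rintro _ ⟨n, rfl⟩
    exact hC f.1 A hA n⟩
  map_add' f g := by
    obtain ⟨k, hk⟩ := Set.mem_iUnion.mp f.2
    obtain ⟨l, hl⟩ := Set.mem_iUnion.mp g.2
    ext n
    have hp : ((j n : ℕ) : WithTop ℕ∞) ≤ (m : WithTop ℕ∞) := by
      exact_mod_cast Nat.lt_succ_iff.mp (j n).2
    change ((1 + |x n| ^ 2) ^ n)⁻¹ * iteratedDeriv (j n) (f.1 + g.1) (x n) =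
      ((1 + |x n| ^ 2) ^ n)⁻¹ * iteratedDeriv (j n) f.1 (x n) +
      ((1 + |x n| ^ 2) ^ n)⁻¹ * iteratedDeriv (j n) g.1 (x n)
    rw [iteratedDeriv_add (hk.1.of_le hp).contDiffAt (hl.1.of_le hp).contDiffAt, mul_add]
  map_smul' c f := by
    ext n
    change ((1 + |x n| ^ 2) ^ n)⁻¹ * iteratedDeriv (j n) (c • f.1) (x n) =
      c * (((1 + |x n| ^ 2) ^ n)⁻¹ * iteratedDeriv (j n) f.1 (x n))
    rw [iteratedDeriv_const_smul_field, smul_eq_mul]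
    ring

theorem sampling_apply (m : ℕ) (j : ℕ → Fin (m + 1)) (x : ℕ → ℝ) (f : LB ℝ m) (n : ℕ) :
    sampling m j x f n = ((1 + |x n| ^ 2) ^ n)⁻¹ * iteratedDeriv (j n) f.1 (x n) :=
  rfl

theorem Step.growthBound {𝕜 : Type*} [RCLike 𝕜] {m n : ℕ} (f : Step 𝕜 m n) :
    GrowthBound m n ‖f‖ f.1 := by
  intro j hj x
  have h : weighted m n f.1 (⟨j, Nat.lt_succ_iff.mpr hj⟩, x) ≤ ‖f‖ := le_ciSup f.2.2 _
  unfold weighted at h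
  rwa [inv_mul_le_iff₀ (by positivity), mul_comm] at h

/-- The topology induced by `sampling` is itself one of the locally convex topologies over which the
infimum is taken, so only continuity on each normed step has to be checked. -/
theorem continuous_sampling (m : ℕ) (j : ℕ → Fin (m + 1)) (x : ℕ → ℝ) :
    Continuous (sampling m j x) := by
  rw [continuous_iff_le_induced]
  refine sInf_le ⟨topologicalAddGroup_induced _, continuousSMul_induced _,
    LocallyConvexSpace.induced _, fun k => ?_⟩
  rw [continuous_induced_rng]
  obtain ⟨C, hC⟩ := exists_sampling_bound m j x k
  let L : Step ℝ m k →+ lp (fun _ : ℕ => ℝ) ⊤ :=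
    { toFun := fun f => sampling m j x f.toLB
      map_zero' := (sampling m j x).map_zero
      map_add' := fun f g => (sampling m j x).map_add f.toLB g.toLB }
  refine AddMonoidHomClass.continuous_of_bound L C fun f => ?_
  have h : ∀ n, ‖L f n‖ ≤ C * ‖f‖ := hC f.1 ‖f‖ f.growthBound
  exact lp.norm_le_of_forall_le ((norm_nonneg _).trans (h 0)) h

/-- A bounded subset of `𝒪_M(ℝ)` is bounded in one of the steps `𝒪ₙᵐ(ℝ)`, for every `m`. -/
theorem exists_uniform_growthBound {B : Set (OM ℝ)} (hB : Bornology.IsVonNBounded ℝ B) (m : ℕ) :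
    ∃ k A, ∀ f ∈ B, GrowthBound m k A (f : ℝ → ℝ) := by
  -- Taking exponent and constant both equal to `n` yields `f n ∈ B` and a point `x n` at which the
  -- estimate fails. Sampling along these points is continuous, hence bounded on `B`, yet its `n`-th
  -- coordinate at `f n` exceeds `n`.
  by_contra! hcon
  have h : ∀ n : ℕ, ∃ f ∈ B, ∃ (j : Fin (m + 1)) (x : ℝ),
      (n : ℝ) * (1 + |x| ^ 2) ^ n < ‖iteratedDeriv j (f : ℝ → ℝ) x‖ := by
    intro n
    obtain ⟨f, hf, hn⟩ := hcon n n
    simp only [GrowthBound] at hn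
    push Not at hn
    obtain ⟨j, hj, x, hx⟩ := hn
    exact ⟨f, hf, ⟨j, Nat.lt_succ_iff.mpr hj⟩, x, hx⟩
  choose f hf j x hx using h
  have hc : Continuous fun g : OM ℝ => sampling m j x (g.toLB m) :=
    (continuous_sampling m j x).comp (continuous_iInf_dom continuous_induced_dom)
  have hV : {g : OM ℝ | ‖sampling m j x (g.toLB m)‖ < 1} ∈ 𝓝 (0 : OM ℝ) := by
    refine (isOpen_lt hc.norm continuous_const).mem_nhds ?_
    have : sampling m j x ((0 : OM ℝ).toLB m) = 0 := (sampling m j x).map_zero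
    simp [this]
  obtain ⟨r, hr, hr'⟩ := (hB hV).exists_pos
  obtain ⟨n, hn⟩ := exists_nat_ge r
  obtain ⟨g, hg, hgf⟩ := hr' r (by rw [Real.norm_of_nonneg hr.le]) (hf n)
  have h1 : sampling m j x ((f n).toLB m) = r • sampling m j x (g.toLB m) := by
    rw [← map_smul]
    exact congrArg (fun h : OM ℝ => sampling m j x (h.toLB m)) hgf.symm
  have h2 : ‖sampling m j x ((f n).toLB m) n‖ ≤ r := by
    refine (lp.norm_apply_le_norm ENNReal.top_ne_zero _ n).trans ?_
    rw [h1, norm_smul, Real.norm_of_nonneg hr.le]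
    have : ‖sampling m j x (g.toLB m)‖ < 1 := hg
    nlinarith
  rw [sampling_apply, norm_mul, norm_inv, Real.norm_of_nonneg (by positivity),
    inv_mul_le_iff₀ (by positivity)] at h2
  have h3 := (hx n).trans_le h2
  have h4 : (0 : ℝ) < (1 + |x n| ^ 2) ^ n := by positivity
  nlinarith

end Regular

/-! ### Dynamics and smoothness of the iterates. -/

section Iterates

theorem perm_pow_strictMono {e : Equiv.Perm ℝ} (he : StrictMono e) (n : ℕ) :
    StrictMono ⇑(e ^ n) := by
  rw [Equiv.Perm.coe_pow]
  exact he.iterate n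

/-- The orbit increases, and a finite limit would be a fixed point. -/
theorem tendsto_perm_pow_atTop {e : Equiv.Perm ℝ} (hc : Continuous e) (hlt : ∀ x, x < e x)
    (x : ℝ) : Tendsto (fun n : ℕ => (e ^ n) x) atTop atTop := by
  have hmono : Monotone fun n : ℕ => (e ^ n) x := monotone_nat_of_le_succ fun n => by
    rw [pow_succ', Equiv.Perm.mul_apply]
    exact (hlt _).le
  rcases tendsto_atTop_of_monotone hmono with h | ⟨l, hl⟩
  · exact h
  · have h1 : Function.IsFixedPt e l := by
      refine isFixedPt_of_tendsto_iterate (x := x) ?_ hc.continuousAt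
      simpa only [Equiv.Perm.coe_pow] using hl
    exact absurd h1 (hlt l).ne'

theorem exists_escape_of_lt {e : Equiv.Perm ℝ} (hc : Continuous e) (hm : StrictMono e)
    (hlt : ∀ x, x < e x) (s R : ℝ) :
    ∃ N : ℕ, ∀ z : ℤ, N ≤ z.natAbs → ∀ x, |x| ≤ s → R < |(e ^ z) x| := by
  obtain ⟨N, hN⟩ := eventually_atTop.mp
    (((tendsto_perm_pow_atTop hc hlt (-s)).eventually_gt_atTop R).and
      ((tendsto_perm_pow_atTop hc hlt (-R)).eventually_gt_atTop s))
  refine ⟨N, fun z hz x hx => ?_⟩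
  obtain ⟨h1, h2⟩ := hN z.natAbs hz
  obtain ⟨hx1, hx2⟩ := abs_le.mp hx
  rcases Int.natAbs_eq z with h | h
  · rw [h, zpow_natCast]
    exact (h1.trans_le ((perm_pow_strictMono hm _).monotone hx1)).trans_le (le_abs_self _)
  · rw [h, zpow_neg, zpow_natCast]
    -- For a negative iterate apply `e ^ n` to `-R ≤ e ^ (-n) x`: this would give `e ^ n (-R) ≤ x ≤
    -- s`, against the choice of `N`.
    refine lt_of_not_ge fun hcon => ?_
    have h3 := (perm_pow_strictMono hm z.natAbs).monotone (abs_le.mp hcon).1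
    rw [← Equiv.Perm.mul_apply, mul_inv_cancel, Equiv.Perm.one_apply] at h3
    linarith

theorem exists_fixedPoint_of_strictAnti {f : ℝ → ℝ} (hc : Continuous f) (ha : StrictAnti f) :
    ∃ x, f x = x := by
  have key : ∀ a b : ℝ, a ≤ f a → f b ≤ b → ∃ x, f x = x := by
    intro a b h1 h2
    obtain ⟨x, hx⟩ := mem_range_of_exists_le_of_exists_ge (hc.sub continuous_id)
      ⟨b, sub_nonpos.mpr h2⟩ ⟨a, sub_nonneg.mpr h1⟩
    exact ⟨x, sub_eq_zero.mp hx⟩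
  rcases le_total 0 (f 0) with h | h
  · exact key 0 (f 0) h (ha.antitone h)
  · exact key (f 0) 0 (ha.antitone h) h

/-- The iterates of a fixed point free continuous bijection move every compact set out of every
compact set. -/
theorem exists_escape {e : Equiv.Perm ℝ} (hc : Continuous e) (hfix : ∀ x, e x ≠ x) (s R : ℝ) :
    ∃ N : ℕ, ∀ z : ℤ, N ≤ z.natAbs → ∀ x, |x| ≤ s → R < |(e ^ z) x| := by
  have hm : StrictMono e := by
    rcases hc.strictMono_of_inj e.injective with h | h
    · exact h
    · obtain ⟨x, hx⟩ := exists_fixedPoint_of_strictAnti hc h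
      exact absurd hx (hfix x)
  have hside : (∀ x, x < e x) ∨ ∀ x, e x < x := by
    by_contra! hcon
    obtain ⟨⟨a, ha⟩, b, hb⟩ := hcon
    obtain ⟨x, hx⟩ := mem_range_of_exists_le_of_exists_ge (hc.sub continuous_id)
      ⟨a, sub_nonpos.mpr ha⟩ ⟨b, sub_nonneg.mpr hb⟩
    exact hfix x (sub_eq_zero.mp hx)
  rcases hside with h | h
  · exact exists_escape_of_lt hc hm h s R
  -- The claim is symmetric under `z ↦ -z`, so a map moving points to the left is replaced by its
  -- inverse.
  · have hm' : StrictMono ⇑e⁻¹ := fun x y hxy => by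
      rw [← hm.lt_iff_lt]
      simpa using hxy
    have hc' : Continuous ⇑e⁻¹ := hm'.monotone.continuous_of_surjective (e⁻¹).surjective
    have hlt : ∀ x, x < e⁻¹ x := fun x => by
      have := h (e⁻¹ x)
      rwa [← Equiv.Perm.mul_apply, mul_inv_cancel, Equiv.Perm.one_apply] at this
    obtain ⟨N, hN⟩ := exists_escape_of_lt hc' hm' hlt s R
    refine ⟨N, fun z hz x hx => ?_⟩
    have := hN (-z) (by rwa [Int.natAbs_neg]) x hx
    rwa [inv_zpow, zpow_neg, inv_inv] at this

theorem contDiff_perm_zpow {e : Equiv.Perm ℝ} (hc : ContDiff ℝ ∞ e) (hd : ∀ x, deriv e x ≠ 0)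
    (hi : Continuous ⇑e⁻¹) (z : ℤ) : ContDiff ℝ ∞ ⇑(e ^ z) := by
  have hinv : ContDiff ℝ ∞ ⇑e⁻¹ := by
    let h : ℝ ≃ₜ ℝ := { e with continuous_toFun := hc.continuous, continuous_invFun := hi }
    exact h.contDiff_symm_deriv hd
      (fun x => ((hc.differentiable (by simp)) x).hasDerivAt) hc
  have hpow : ∀ (a : Equiv.Perm ℝ), ContDiff ℝ ∞ a → ∀ n : ℕ, ContDiff ℝ ∞ ⇑(a ^ n) := by
    intro a ha n
    induction n with
    | zero => exact contDiff_id
    | succ n ih => rw [pow_succ]; exact ih.comp ha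
  rcases Int.natAbs_eq z with h | h
  · rw [h, zpow_natCast]
    exact hpow e hc _
  · rw [h, zpow_neg, zpow_natCast, ← inv_pow]
    exact hpow _ hinv _

theorem continuous_perm_inv {e : Equiv.Perm ℝ} (hc : Continuous e) : Continuous ⇑e⁻¹ := by
  rcases hc.strictMono_of_inj e.injective with h | h
  · have : Monotone ⇑e⁻¹ := fun x y hxy => by
      rw [← h.le_iff_le]
      simpa using hxy
    exact this.continuous_of_surjective (e⁻¹).surjective
  · have : Antitone ⇑e⁻¹ := fun x y hxy => by
      rw [← h.le_iff_ge]
      simpa using hxy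
    exact this.dual_right.continuous_of_surjective (e⁻¹).surjective

end Iterates

/-! ### Test functions composed with the iterates. -/

section Composition

variable {𝕜 : Type*} [RCLike 𝕜]

theorem exists_growthBound_of_hasCompactSupport {p : ℝ → 𝕜} (hp : ContDiff ℝ ∞ p)
    (hs : HasCompactSupport p) (m : ℕ) : ∃ A, GrowthBound m 0 A p := by
  have h : ∀ j : ℕ, ∃ C, ∀ x, ‖iteratedDeriv j p x‖ ≤ C := by
    intro j
    obtain ⟨C, hC⟩ := (hs.iteratedFDeriv (𝕜 := ℝ) j).exists_bound_of_continuous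
      (hp.continuous_iteratedFDeriv (by exact_mod_cast le_top))
    exact ⟨C, fun x => by rw [← norm_iteratedFDeriv_eq_norm_iteratedDeriv]; exact hC x⟩
  choose C hC using h
  refine ⟨∑ j ∈ Finset.range (m + 1), C j, fun j hj x => ?_⟩
  rw [pow_zero, mul_one]
  exact (hC j x).trans (Finset.single_le_sum (f := C)
    (fun i _ => (norm_nonneg _).trans (hC i 0)) (Finset.mem_range.mpr (by lia)))

/-- Faà di Bruno's estimate needs the `i`-th derivative of `φ` bounded by the `i`-th power of one
number `D`; the condition `1 ≤ C` gives `D ≥ 1`, so the bound `D` itself suffices. Exponent `0` for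
`p` avoids any estimate of `φ` itself. -/
theorem GrowthBound.comp {m N : ℕ} {A C : ℝ} {p : ℝ → 𝕜} {φ : ℝ → ℝ} (cp : ContDiff ℝ ∞ p)
    (cφ : ContDiff ℝ ∞ φ) (hp : GrowthBound m 0 A p) (hφ : GrowthBound m N C (deriv φ))
    (hC : 1 ≤ C) : GrowthBound m (N * m) (m.factorial * A * C ^ m) (p ∘ φ) := by
  intro j hj x
  have hA := hp.nonneg
  have hD : 1 ≤ C * (1 + |x| ^ 2) ^ N :=
    one_le_mul_of_one_le_of_one_le hC (one_le_pow₀ (one_le_weight x))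
  rw [← norm_iteratedFDeriv_eq_norm_iteratedDeriv]
  refine (norm_iteratedFDeriv_comp_le cp cφ (by exact_mod_cast le_top) x (C := A)
    (D := C * (1 + |x| ^ 2) ^ N) ?_ ?_).trans ?_
  · intro i hi
    rw [norm_iteratedFDeriv_eq_norm_iteratedDeriv]
    simpa using hp i (hi.trans hj) (φ x)
  · intro i h1 hi
    obtain ⟨i, rfl⟩ := Nat.exists_eq_succ_of_ne_zero (by lia : i ≠ 0)
    rw [norm_iteratedFDeriv_eq_norm_iteratedDeriv, iteratedDeriv_succ']
    exact (hφ i (by lia) x).trans (le_self_pow₀ hD (by lia))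
  · calc (j.factorial : ℝ) * A * (C * (1 + |x| ^ 2) ^ N) ^ j
        ≤ m.factorial * A * (C * (1 + |x| ^ 2) ^ N) ^ m := by gcongr
      _ = m.factorial * A * C ^ m * (1 + |x| ^ 2) ^ (N * m) := by rw [mul_pow, pow_mul]; ring

/-- If the derivatives of the iterates are bounded in `𝒪_M(ℝ)`, then the orbit of a test function
tends to zero, in steps that do not depend on the test function. -/
theorem exists_step_test_comp_zpow {e : Equiv.Perm ℝ} (hfix : ∀ x, e x ≠ x)
    (hc : ∀ z : ℤ, ContDiff ℝ ∞ ⇑(e ^ z))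
    (hb : ∀ m, ∃ k A, ∀ z : ℤ, GrowthBound m k A (deriv ⇑(e ^ z))) :
    ∃ K : ℕ → ℕ, ∀ (m : ℕ) (p : ℝ → 𝕜), ContDiff ℝ ∞ p → HasCompactSupport p →
      (∃ A, ∀ z : ℤ, GrowthBound m (K m) A (p ∘ ⇑(e ^ z))) ∧
      ∀ ε > 0, ∃ N : ℕ, ∀ z : ℤ, N ≤ z.natAbs → GrowthBound m (K m) ε (p ∘ ⇑(e ^ z)) := by
  choose k A hA using hb
  -- The exponent `k m * m` comes from the chain rule; the `+ 1` is the weight spent in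
  -- `GrowthBound.gain`. Neither involves `p`.
  refine ⟨fun m => k m * m + 1, fun m p cp hp => ?_⟩
  obtain ⟨B, hB⟩ := exists_growthBound_of_hasCompactSupport cp hp m
  have hcomp : ∀ z : ℤ, GrowthBound m (k m * m) (m.factorial * B * (max 1 (A m)) ^ m)
      (p ∘ ⇑(e ^ z)) := fun z =>
    hB.comp cp (hc z) ((hA m z).mono le_rfl le_rfl (le_max_right _ _)) (le_max_left _ _)
  refine ⟨⟨_, fun z => (hcomp z).mono le_rfl (Nat.le_succ _) le_rfl⟩, fun ε hε => ?_⟩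
  set D := m.factorial * B * (max 1 (A m)) ^ m
  have hD : 0 ≤ D := (hcomp 0).nonneg
  obtain ⟨s, hs⟩ := hp.isCompact.isBounded.subset_closedBall 0
  have he : Continuous e := by simpa using (hc 1).continuous
  obtain ⟨N, hN⟩ := exists_escape he hfix (D / ε) s
  refine ⟨N, fun z hz => (hcomp z).gain (R := D / ε) hε.le (by positivity) ?_ fun x hx => ?_⟩
  · have h1 : D = ε * (D / ε) := by field_simp
    have h2 : 0 ≤ D / ε := by positivity
    have h3 : D / ε ≤ 1 + (D / ε) ^ 2 := by nlinarith [sq_nonneg (D / ε - 1)]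
    calc D = ε * (D / ε) := h1
      _ ≤ _ := by gcongr
  · have h1 : (e ^ z) x ∉ tsupport p := fun hmem => by
      have := hs hmem
      rw [mem_closedBall_zero_iff, Real.norm_eq_abs] at this
      exact (hN z hz x hx).not_ge this
    have h2 := (hc z).continuous.continuousAt.eventually (notMem_tsupport_iff_eventuallyEq.mp h1)
    exact h2

end Composition

/-! ### Density and separability of the test functions. -/

section Density

variable {𝕜 : Type*} [RCLike 𝕜]

theorem GrowthBound.mul {m k : ℕ} {A B : ℝ} {f g : ℝ → 𝕜} (cf : ContDiff ℝ ∞ f)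
    (cg : ContDiff ℝ ∞ g) (hf : GrowthBound m k A f) (hg : GrowthBound m 0 B g) :
    GrowthBound m k (2 ^ m * A * B) (f * g) := by
  intro j hj x
  have hA := hf.nonneg
  have hB := hg.nonneg
  rw [← norm_iteratedFDeriv_eq_norm_iteratedDeriv]
  refine (norm_iteratedFDeriv_mul_le cf cg x (n := j) (by exact_mod_cast le_top)).trans ?_
  calc ∑ i ∈ Finset.range (j + 1), (j.choose i : ℝ) * ‖iteratedFDeriv ℝ i f x‖ *
        ‖iteratedFDeriv ℝ (j - i) g x‖
      ≤ ∑ i ∈ Finset.range (j + 1), (j.choose i : ℝ) * (A * (1 + |x| ^ 2) ^ k) * B := by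
        refine Finset.sum_le_sum fun i hi => ?_
        have hi' : i ≤ j := Nat.lt_succ_iff.mp (Finset.mem_range.mp hi)
        have h1 := hf i (hi'.trans hj) x
        have h2 := hg (j - i) ((Nat.sub_le _ _).trans hj) x
        rw [pow_zero, mul_one] at h2
        rw [norm_iteratedFDeriv_eq_norm_iteratedDeriv, norm_iteratedFDeriv_eq_norm_iteratedDeriv]
        gcongr
    _ = 2 ^ j * A * B * (1 + |x| ^ 2) ^ k := by
        rw [← Finset.sum_mul, ← Finset.sum_mul, ← Nat.cast_sum, Nat.sum_range_choose]
        push_cast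
        ring
    _ ≤ _ := by gcongr; exact one_le_two

/-- A smooth cut-off function, equal to `1` on `[-2, 2]` and supported in `[-4, 4]`. -/
noncomputable def cutoff (𝕜 : Type*) [RCLike 𝕜] (x : ℝ) : 𝕜 :=
  (((⟨2, 4, two_pos, by norm_num⟩ : ContDiffBump (0 : ℝ)) x : ℝ) : 𝕜)

theorem contDiff_cutoff : ContDiff ℝ ∞ (cutoff 𝕜) :=
  (RCLike.ofRealCLM (K := 𝕜)).contDiff.comp (ContDiffBump.contDiff _)

theorem cutoff_eq_one {x : ℝ} (hx : |x| ≤ 2) : cutoff 𝕜 x = 1 := by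
  unfold cutoff
  rw [ContDiffBump.one_of_mem_closedBall, RCLike.ofReal_one]
  simpa using hx

theorem cutoff_eq_zero {x : ℝ} (hx : 4 ≤ |x|) : cutoff 𝕜 x = 0 := by
  unfold cutoff
  rw [ContDiffBump.zero_of_le_dist, RCLike.ofReal_zero]
  simpa using hx

theorem hasCompactSupport_cutoff : HasCompactSupport (cutoff 𝕜) :=
  HasCompactSupport.intro (isCompact_closedBall (0 : ℝ) 4) fun x hx => cutoff_eq_zero (by
    simpa using (not_le.mp (fun h => hx (by simpa using h))).le)

/-- A compactly supported function that agrees with `f` on `[-2(R + 1), 2(R + 1)]`. -/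
noncomputable def truncate (f : ℝ → 𝕜) (R : ℕ) : ℝ → 𝕜 :=
  f * fun x => cutoff 𝕜 ((R + 1 : ℝ)⁻¹ * x)

theorem contDiff_dilate_cutoff (c : ℝ) : ContDiff ℝ ∞ fun x => cutoff 𝕜 (c * x) :=
  contDiff_cutoff.comp (contDiff_const.mul contDiff_id)

theorem contDiff_truncate {f : ℝ → 𝕜} (hf : ContDiff ℝ ∞ f) (R : ℕ) :
    ContDiff ℝ ∞ (truncate f R) :=
  hf.mul (contDiff_dilate_cutoff _)

theorem hasCompactSupport_truncate (f : ℝ → 𝕜) (R : ℕ) : HasCompactSupport (truncate f R) := by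
  refine HasCompactSupport.mul_left ?_
  refine HasCompactSupport.intro (isCompact_closedBall (0 : ℝ) (4 * (R + 1))) fun x hx => ?_
  refine cutoff_eq_zero ?_
  have h : 4 * (R + 1 : ℝ) < |x| := by simpa using hx
  rw [abs_mul, abs_of_nonneg (by positivity : (0 : ℝ) ≤ (R + 1 : ℝ)⁻¹), inv_mul_eq_div,
    le_div_iff₀ (by positivity)]
  exact h.le

/-- Dilating the cut-off by a factor at most `1` does not enlarge its derivatives, so the
differences are bounded uniformly in `R`; they vanish near `[-R, R]`, and one extra weight makes
them small. -/
theorem stepwiseNull_truncate_sub (f : OM 𝕜) :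
    StepwiseNull fun R => truncate (f : ℝ → 𝕜) R - (f : ℝ → 𝕜) := by
  intro m
  obtain ⟨k, A, hA⟩ := f.exists_growthBound m
  obtain ⟨B, hB⟩ := exists_growthBound_of_hasCompactSupport (contDiff_cutoff (𝕜 := 𝕜))
    hasCompactSupport_cutoff m
  have hdil : ∀ R : ℕ, GrowthBound m 0 B fun x => cutoff 𝕜 ((R + 1 : ℝ)⁻¹ * x) := by
    intro R j hj x
    have h := congrFun (iteratedDeriv_comp_const_smul (n := j)
      ((contDiff_cutoff (𝕜 := 𝕜)).of_le (by exact_mod_cast le_top)) ((R + 1 : ℝ)⁻¹)) x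
    rw [h, norm_smul, norm_pow, norm_inv, Real.norm_of_nonneg (by positivity : (0 : ℝ) ≤ R + 1)]
    have h1 := hB j hj ((R + 1 : ℝ)⁻¹ * x)
    rw [pow_zero, mul_one] at h1 ⊢
    have h2 : ((R + 1 : ℝ)⁻¹) ^ j ≤ 1 :=
      pow_le_one₀ (by positivity) (inv_le_one_of_one_le₀ (by simp))
    calc _ ≤ 1 * ‖iteratedDeriv j (cutoff 𝕜) ((R + 1 : ℝ)⁻¹ * x)‖ := by gcongr
      _ ≤ B := by rwa [one_mul]
  have hneg : GrowthBound m k A (-(f : ℝ → 𝕜)) := fun j hj x => by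
    rw [iteratedDeriv_neg, norm_neg]
    exact hA j hj x
  have hD : ∀ R : ℕ, GrowthBound m k (2 ^ m * A * B + A)
      (truncate (f : ℝ → 𝕜) R - (f : ℝ → 𝕜)) := fun R => by
    rw [sub_eq_add_neg]
    exact (hA.mul f.contDiff (contDiff_dilate_cutoff _) (hdil R)).add hneg
      (contDiff_truncate f.contDiff R) f.contDiff.neg
  refine ⟨k + 1, fun ε hε => ?_⟩
  obtain ⟨N, hN⟩ := exists_nat_ge ((2 ^ m * A * B + A) / ε)
  filter_upwards [eventually_ge_atTop N] with R hR
  refine (hD R).gain (R := R) hε.le (by positivity) ?_ fun x hx => ?_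
  · have h1 : (N : ℝ) ≤ R := by exact_mod_cast hR
    have h2 : (R : ℝ) ≤ 1 + (R : ℝ) ^ 2 := by nlinarith [sq_nonneg ((R : ℝ) - 1)]
    rw [div_le_iff₀ hε] at hN
    nlinarith
  · have h1 : {y : ℝ | |y| < R + 1} ∈ 𝓝 x :=
      (isOpen_lt continuous_abs continuous_const).mem_nhds (by simpa using hx.trans_lt (by simp))
    filter_upwards [h1] with y hy
    have h2 : cutoff 𝕜 ((R + 1 : ℝ)⁻¹ * y) = 1 := by
      refine cutoff_eq_one ?_
      have hy' : |y| < R + 1 := hy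
      rw [abs_mul, abs_of_nonneg (by positivity : (0 : ℝ) ≤ (R + 1 : ℝ)⁻¹), inv_mul_eq_div,
        div_le_iff₀ (by positivity)]
      linarith
    simp [truncate, h2]

/-- The smooth functions supported in `[-R, R]`, with all their derivatives. -/
def testJets (𝕜 : Type*) [RCLike 𝕜] (R : ℕ) : Set (ℕ → C(ℝ, 𝕜)) :=
  {F | ContDiff ℝ ∞ (F 0) ∧ tsupport (F 0) ⊆ Metric.closedBall 0 R ∧
    ∀ j x, F j x = iteratedDeriv j (F 0) x}

/-- Sending a function to all its derivatives embeds the test functions into a countable product of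
separable metrizable spaces `C(ℝ, 𝕜)`, whose subsets are again separable. Closeness on the ball is
global closeness, since both functions vanish outside it. -/
theorem exists_seq_dense_test_of_support (𝕜 : Type*) [RCLike 𝕜] (R : ℕ) :
    ∃ p : ℕ → ℝ → 𝕜, (∀ i, ContDiff ℝ ∞ (p i)) ∧ (∀ i, HasCompactSupport (p i)) ∧
      ∀ φ : ℝ → 𝕜, ContDiff ℝ ∞ φ → tsupport φ ⊆ Metric.closedBall 0 R → ∀ (m : ℕ), ∀ ε > 0,
        ∃ i, GrowthBound m 0 ε (p i - φ) := by
  have hjet : ∀ φ : ℝ → 𝕜, ContDiff ℝ ∞ φ → tsupport φ ⊆ Metric.closedBall 0 R →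
      ∃ F : testJets 𝕜 R, ⇑(F.1 0) = φ := by
    intro φ hφ hs
    refine ⟨⟨fun j => ⟨iteratedDeriv j φ, hφ.continuous_iteratedDeriv j (by exact_mod_cast le_top)⟩,
      ?_, ?_, ?_⟩, ?_⟩
    · simpa using hφ
    · simpa using hs
    · intro j x
      simp
    · simp
  have : Nonempty (testJets 𝕜 R) :=
    ⟨(hjet 0 contDiff_const (by simp [tsupport])).choose⟩
  let q := TopologicalSpace.denseSeq (testJets 𝕜 R)
  refine ⟨fun i => (q i).1 0, fun i => (q i).2.1, fun i =>
    (isCompact_closedBall (0 : ℝ) (R : ℝ)).of_isClosed_subset (isClosed_tsupport _) (q i).2.2.1,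
    fun φ hφ hs m ε hε => ?_⟩
  obtain ⟨F, hF⟩ := hjet φ hφ hs
  have hF' : ∀ j x, F.1 j x = iteratedDeriv j φ x := fun j x => by rw [F.2.2.2 j x, hF]
  have hcl : F ∈ closure (Set.range q) := TopologicalSpace.denseRange_denseSeq _ F
  have hnear : ∀ j, ∀ᶠ G : testJets 𝕜 R in 𝓝 F, ∀ x ∈ Metric.closedBall (0 : ℝ) R,
      dist (F.1 j x) (G.1 j x) < ε := by
    intro j
    have h1 : Tendsto (fun G : testJets 𝕜 R => G.1 j) (𝓝 F) (𝓝 (F.1 j)) :=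
      ((continuous_apply j).comp continuous_subtype_val).tendsto F
    have h2 := ContinuousMap.tendsto_iff_forall_isCompact_tendstoUniformlyOn.mp h1 _
      (isCompact_closedBall (0 : ℝ) (R : ℝ))
    exact Metric.tendstoUniformlyOn_iff.mp h2 ε hε
  have hall : ∀ᶠ G : testJets 𝕜 R in 𝓝 F, ∀ j ∈ Finset.range (m + 1),
      ∀ x ∈ Metric.closedBall (0 : ℝ) R, dist (F.1 j x) (G.1 j x) < ε :=
    (Filter.eventually_all_finset _).mpr fun j _ => hnear j
  obtain ⟨_, hG, i, rfl⟩ := mem_closure_iff_nhds.mp hcl _ hall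
  refine ⟨i, fun j hj x => ?_⟩
  rw [pow_zero, mul_one]
  by_cases hx : x ∈ Metric.closedBall (0 : ℝ) R
  · have h1 := hG j (Finset.mem_range.mpr (by lia)) x hx
    rw [iteratedDeriv_sub ((q i).2.1.of_le (by exact_mod_cast le_top)).contDiffAt
      (hφ.of_le (by exact_mod_cast le_top)).contDiffAt, ← (q i).2.2.2 j x, ← hF' j x,
      ← dist_eq_norm, dist_comm]
    exact h1.le
  · have h0 : (⇑((q i).1 0) - φ) =ᶠ[𝓝 x] fun _ => 0 := by
      filter_upwards [notMem_tsupport_iff_eventuallyEq.mp fun h => hx ((q i).2.2.1 h),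
        notMem_tsupport_iff_eventuallyEq.mp fun h => hx (hs h)] with y h1 h2
      simp [h1, h2]
    rw [h0.iteratedDeriv_eq, iteratedDeriv_const]
    split_ifs <;> simpa using hε.le

/-- The second component of the outer pairing is a dummy that repeats each function infinitely
often. Large indices are needed because the orbit approximates the `l`-th function only to an
accuracy depending on `l`. -/
theorem exists_seq_dense_test (𝕜 : Type*) [RCLike 𝕜] :
    ∃ p : ℕ → ℝ → 𝕜, (∀ i, ContDiff ℝ ∞ (p i)) ∧ (∀ i, HasCompactSupport (p i)) ∧
      ∀ φ : ℝ → 𝕜, ContDiff ℝ ∞ φ → HasCompactSupport φ → ∀ (m N : ℕ), ∀ ε > 0,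
        ∃ i ≥ N, GrowthBound m 0 ε (p i - φ) := by
  choose q hq hqs hqd using exists_seq_dense_test_of_support 𝕜
  refine ⟨fun i => q i.unpair.1.unpair.1 i.unpair.1.unpair.2, fun i => hq _ _,
    fun i => hqs _ _, fun φ hφ hs m N ε hε => ?_⟩
  obtain ⟨s, hs'⟩ := hs.isCompact.isBounded.subset_closedBall 0
  obtain ⟨R, hR⟩ := exists_nat_ge s
  obtain ⟨i, hi⟩ := hqd R φ hφ (hs'.trans (Metric.closedBall_subset_closedBall hR)) m ε hε
  refine ⟨Nat.pair (Nat.pair R i) N, Nat.right_le_pair _ _, ?_⟩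
  simpa only [Nat.unpair_pair] using hi

end Density

/-! ### Construction of the hypercyclic vector. -/

section Series

variable {𝕜 : Type*} [RCLike 𝕜]

theorem GrowthBound.sum {m k : ℕ} {A : ℕ → ℝ} {q : ℕ → ℝ → 𝕜} (cq : ∀ i, ContDiff ℝ ∞ (q i))
    {s : Finset ℕ} (hq : ∀ i ∈ s, GrowthBound m k (A i) (q i)) :
    GrowthBound m k (∑ i ∈ s, A i) (∑ i ∈ s, q i) := by
  classical
  induction s using Finset.induction_on with
  | empty =>
    intro j _ x
    have h : iteratedDeriv j (fun _ : ℝ => (0 : 𝕜)) x = 0 := by simp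
    rw [Finset.sum_empty, Finset.sum_empty, zero_mul]
    exact (norm_eq_zero.mpr h).le
  | insert i s hi ih =>
    rw [Finset.sum_insert hi, Finset.sum_insert hi]
    refine (hq i (Finset.mem_insert_self i s)).add
      (ih fun l hl => hq l (Finset.mem_insert_of_mem hl)) (cq i) ?_
    have := ContDiff.sum (s := s) fun l _ => cq l
    convert this using 1
    ext x
    simp

theorem growthBound_of_eventuallyEq_sum {m k : ℕ} {A : ℕ → ℝ} {B : ℝ} {q : ℕ → ℝ → 𝕜}
    {F : ℝ → 𝕜} (cq : ∀ i, ContDiff ℝ ∞ (q i))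
    (hF : ∀ x, ∃ s : Finset ℕ, (∀ i ∈ s, GrowthBound m k (A i) (q i)) ∧ ∑ i ∈ s, A i ≤ B ∧
      F =ᶠ[𝓝 x] ∑ i ∈ s, q i) : GrowthBound m k B F := by
  intro j hj x
  obtain ⟨s, hs, hB, he⟩ := hF x
  rw [he.iteratedDeriv_eq]
  exact ((GrowthBound.sum cq hs).mono le_rfl le_rfl hB) j hj x

/-- Recursive choice: at stage `i + 1` only finitely many `l ≤ i` and values `a ≤ n i` can occur,
and adding up all their thresholds dominates each one. -/
theorem exists_seq_of_eventually {Q : ℕ → ℕ → ℕ → ℕ → Prop}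
    (h : ∀ l i a, ∀ᶠ n in atTop, Q l i a n) :
    ∃ n : ℕ → ℕ, ∀ l i, l < i → Q l i (n l) (n i) := by
  have h' : ∀ l i a, ∃ N, ∀ n ≥ N, Q l i a n := fun l i a => eventually_atTop.mp (h l i a)
  choose N hN using h'
  let n : ℕ → ℕ := fun i => Nat.rec 0 (fun i b =>
    b + ∑ l ∈ Finset.range (i + 1), ∑ a ∈ Finset.range (b + 1), N l (i + 1) a) i
  have hn : ∀ i, n (i + 1) = n i +
      ∑ l ∈ Finset.range (i + 1), ∑ a ∈ Finset.range (n i + 1), N l (i + 1) a := fun i => rfl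
  have hmono : Monotone n := monotone_nat_of_le_succ fun i => by rw [hn]; exact Nat.le_add_right _ _
  refine ⟨n, fun l i hl => hN _ _ _ _ ?_⟩
  obtain ⟨i, rfl⟩ := Nat.exists_eq_succ_of_ne_zero (by lia : i ≠ 0)
  have hli : l ≤ i := Nat.lt_succ_iff.mp hl
  rw [Nat.succ_eq_add_one, hn]
  calc N l (i + 1) (n l) ≤ ∑ a ∈ Finset.range (n i + 1), N l (i + 1) a :=
        Finset.single_le_sum (f := fun a => N l (i + 1) a) (fun _ _ => Nat.zero_le _)
          (Finset.mem_range.mpr (Nat.lt_succ_iff.mpr (hmono hli)))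
    _ ≤ ∑ l ∈ Finset.range (i + 1), ∑ a ∈ Finset.range (n i + 1), N l (i + 1) a :=
        Finset.single_le_sum (f := fun l => ∑ a ∈ Finset.range (n i + 1), N l (i + 1) a)
          (fun _ _ => Nat.zero_le _) (Finset.mem_range.mpr hl)
    _ ≤ _ := Nat.le_add_left _ _

theorem sum_half_pow_le (s : Finset ℕ) : ∑ i ∈ s, (1 / 2 : ℝ) ^ i ≤ 2 :=
  (summable_geometric_two.sum_le_tsum s fun i _ => by positivity).trans
    tsum_geometric_two.le

/-- For test functions `p i` there are one function `S` in `𝒪_M(ℝ)` and times `n l` at which the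
orbit of `S` is asymptotic to `p l`. -/
theorem exists_orbit_approximating {e : Equiv.Perm ℝ} (hfix : ∀ x, e x ≠ x)
    (hc : ∀ z : ℤ, ContDiff ℝ ∞ ⇑(e ^ z)) {K : ℕ → ℕ}
    (hK : ∀ (m : ℕ) (p : ℝ → 𝕜), ContDiff ℝ ∞ p → HasCompactSupport p →
      (∃ A, ∀ z : ℤ, GrowthBound m (K m) A (p ∘ ⇑(e ^ z))) ∧
      ∀ ε > 0, ∃ N : ℕ, ∀ z : ℤ, N ≤ z.natAbs → GrowthBound m (K m) ε (p ∘ ⇑(e ^ z)))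
    {p : ℕ → ℝ → 𝕜} (cp : ∀ i, ContDiff ℝ ∞ (p i)) (hp : ∀ i, HasCompactSupport (p i)) :
    ∃ (S : OM 𝕜) (n : ℕ → ℕ), ∀ m l, m ≤ l →
      GrowthBound m (K m) (2 * (1 / 2) ^ l) ((S : ℝ → 𝕜) ∘ ⇑(e ^ n l) - p l) := by
  have hsmall : ∀ (i m a : ℕ) (ε : ℝ), 0 < ε → ∀ᶠ n : ℕ in atTop,
      GrowthBound m (K m) ε (p i ∘ ⇑(e ^ ((a : ℤ) - n))) ∧
      GrowthBound m (K m) ε (p i ∘ ⇑(e ^ ((n : ℤ) - a))) := by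
    intro i m a ε hε
    obtain ⟨N, hN⟩ := (hK m (p i) (cp i) (hp i)).2 ε hε
    filter_upwards [eventually_ge_atTop (N + a)] with n hn
    exact ⟨hN _ (by lia), hN _ (by lia)⟩
  have hvanish : ∀ i : ℕ, ∀ᶠ n : ℕ in atTop, ∀ x : ℝ, |x| ≤ i → p i ((e ^ (-(n : ℤ))) x) = 0 := by
    intro i
    obtain ⟨s, hs⟩ := (hp i).isCompact.isBounded.subset_closedBall 0
    have he : Continuous e := by simpa using (hc 1).continuous
    obtain ⟨N, hN⟩ := exists_escape he hfix i s
    filter_upwards [eventually_ge_atTop N] with n hn x hx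
    refine image_eq_zero_of_notMem_tsupport fun hmem => ?_
    have := hs hmem
    rw [mem_closedBall_zero_iff, Real.norm_eq_abs] at this
    exact (hN (-(n : ℤ)) (by lia) x hx).not_ge this
  -- The first two bounds control the cross terms on both sides of `l`, with factors summable in `i`
  -- and small in `l`. The third puts the sum into one step, and the vanishing on `[-i, i]` makes it
  -- locally finite.
  obtain ⟨n, hn⟩ := exists_seq_of_eventually (Q := fun l i a n =>
    (∀ m ∈ Set.Iic i,
      GrowthBound m (K m) ((1 / 2) ^ i * (1 / 2) ^ l) (p i ∘ ⇑(e ^ ((a : ℤ) - n))) ∧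
      GrowthBound m (K m) ((1 / 2) ^ l * (1 / 2) ^ i) (p l ∘ ⇑(e ^ ((n : ℤ) - a))) ∧
      GrowthBound m (K m) ((1 / 2) ^ i) (p i ∘ ⇑(e ^ (-(n : ℤ))))) ∧
    ∀ x : ℝ, |x| ≤ i → p i ((e ^ (-(n : ℤ))) x) = 0) (by
      intro l i a
      refine Eventually.and ?_ (hvanish i)
      refine (eventually_all_finite (Set.finite_Iic i)).mpr fun m _ => ?_
      filter_upwards [hsmall i m a ((1 / 2) ^ i * (1 / 2) ^ l) (by positivity),
        hsmall l m a ((1 / 2) ^ l * (1 / 2) ^ i) (by positivity),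
        hsmall i m 0 ((1 / 2) ^ i) (by positivity)] with n h1 h2 h3
      exact ⟨h1.1, h2.2, by simpa using h3.1⟩)
  let q : ℕ → ℝ → 𝕜 := fun i => p i ∘ ⇑(e ^ (-(n i : ℤ)))
  have cq : ∀ i, ContDiff ℝ ∞ (q i) := fun i => (cp i).comp (hc _)
  have hq0 : ∀ (i : ℕ) (x : ℝ), |x| < i → q i x = 0 := by
    intro i x hx
    have hi : 0 < i := by exact_mod_cast (abs_nonneg x).trans_lt hx
    exact (hn 0 i hi).2 x hx.le
  let S : ℝ → 𝕜 := fun x => ∑' i, q i x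
  have hS : ∀ (R : ℕ) (x : ℝ), |x| < R → S x = ∑ i ∈ Finset.range R, q i x := by
    intro R x hx
    refine tsum_eq_sum fun i hi => hq0 i x (hx.trans_le ?_)
    exact_mod_cast not_lt.mp fun h => hi (Finset.mem_range.mpr h)
  have hSloc : ∀ (R : ℕ) (x : ℝ), |x| < R → S =ᶠ[𝓝 x] ∑ i ∈ Finset.range R, q i := by
    intro R x hx
    filter_upwards [(isOpen_lt continuous_abs continuous_const).mem_nhds hx] with y hy
    rw [hS R y hy, Finset.sum_apply]
  have cS : ContDiff ℝ ∞ S := contDiff_iff_contDiffAt.mpr fun x => by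
    obtain ⟨R, hR⟩ := exists_nat_gt |x|
    refine ContDiffAt.congr_of_eventuallyEq ?_ (hSloc R x hR)
    have := ContDiff.sum (s := Finset.range R) fun l _ => cq l
    convert this.contDiffAt (x := x) using 1
    ext y
    exact Finset.sum_apply _ _ _
  have bS : ∀ m, ∃ k A, GrowthBound m k A S := by
    intro m
    have hbd : ∀ i, ∃ C, GrowthBound m (K m) C (q i) := fun i =>
      let ⟨A, hA⟩ := (hK m (p i) (cp i) (hp i)).1
      ⟨A, hA _⟩
    choose C hC using hbd
    -- Smallness of `q i` at order `m` is known only for `i > m`; the finitely many earlier terms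
    -- use their individual bounds `C i`.
    let A : ℕ → ℝ := fun i => (if i ≤ m then C i else 0) + (1 / 2) ^ i
    have hA0 : ∀ i, 0 ≤ A i := fun i => by
      have := (hC i).nonneg
      dsimp only [A]
      split_ifs <;> positivity
    have hAs : Summable A := by
      refine Summable.add (summable_of_ne_finset_zero (s := Finset.range (m + 1)) fun i hi => ?_)
        summable_geometric_two
      exact if_neg fun h => hi (Finset.mem_range.mpr (Nat.lt_succ_iff.mpr h))
    refine ⟨K m, ∑' i, A i, growthBound_of_eventuallyEq_sum (A := A) cq fun x => ?_⟩
    obtain ⟨R, hR⟩ := exists_nat_gt |x|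
    refine ⟨Finset.range R, fun i _ => ?_, hAs.sum_le_tsum _ fun i _ => hA0 i, hSloc R x hR⟩
    rcases le_or_gt i m with him | him
    · refine (hC i).mono le_rfl le_rfl ?_
      simp only [A, if_pos him]
      have : (0 : ℝ) ≤ (1 / 2) ^ i := by positivity
      linarith
    · refine ((hn 0 i (by lia)).1 m him.le).2.2.mono le_rfl le_rfl ?_
      simp [A, not_le.mpr him]
  refine ⟨⟨S, mem_omSubmodule_of_growthBound cS bS⟩, n, fun m l hml => ?_⟩
  change GrowthBound m (K m) (2 * (1 / 2) ^ l) (S ∘ ⇑(e ^ n l) - p l)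
  refine growthBound_of_eventuallyEq_sum (A := fun i => (1 / 2) ^ i * (1 / 2) ^ l)
    (q := fun i => p i ∘ ⇑(e ^ ((n l : ℤ) - n i))) (fun i => (cp i).comp (hc _)) fun x => ?_
  -- Having `R > l` guarantees that the partial sum contains the term `i = l`, which is exactly `p
  -- l` and cancels.
  obtain ⟨R, hR⟩ := exists_nat_gt (max |(e ^ n l) x| l)
  have hlR : l < R := by exact_mod_cast (le_max_right _ _).trans_lt hR
  refine ⟨(Finset.range R).erase l, fun i hi => ?_, ?_, ?_⟩
  · rcases lt_or_gt_of_ne (Finset.ne_of_mem_erase hi) with h | h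
    · exact ((hn i l h).1 m hml).2.1
    · exact ((hn l i h).1 m (hml.trans h.le)).1
  · rw [← Finset.sum_mul]
    exact mul_le_mul_of_nonneg_right (sum_half_pow_le _) (by positivity)
  · have hcont : Continuous ⇑(e ^ n l) := by simpa using (hc (n l)).continuous
    have h1 := hcont.continuousAt.eventually (hSloc R _ ((le_max_left _ _).trans_lt hR))
    filter_upwards [h1] with y hy
    have h2 : ∀ i, q i ((e ^ n l) y) = p i ((e ^ ((n l : ℤ) - n i)) y) := fun i => by
      simp only [q, Function.comp_apply]
      rw [← zpow_natCast e (n l), ← Equiv.Perm.mul_apply, ← zpow_add, neg_add_eq_sub]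
    rw [Pi.sub_apply, Function.comp_apply, hy, Finset.sum_apply, Finset.sum_apply,
      ← Finset.add_sum_erase _ _ (Finset.mem_range.mpr hlR), h2 l, sub_self, zpow_zero,
      Equiv.Perm.one_apply, add_sub_cancel_left]
    exact Finset.sum_congr rfl fun i _ => h2 i

end Series

/-! ### Hypercyclicity and mixing of the composition operator. -/

section Dynamics

variable {𝕜 : Type*} [RCLike 𝕜]

theorem coe_compOp_iterate (ψ : OM ℝ) (hbij : Function.Bijective ψ) (n : ℕ) (f : OM 𝕜) :
    (((compOp 𝕜 ψ)^[n] f : OM 𝕜) : ℝ → 𝕜) =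
      (f : ℝ → 𝕜) ∘ ⇑((Equiv.ofBijective ψ hbij : Equiv.Perm ℝ) ^ n) := by
  induction n with
  | zero => rfl
  | succ n ih =>
    rw [Function.iterate_succ_apply', pow_succ]
    have h : ((compOp 𝕜 ψ ((compOp 𝕜 ψ)^[n] f) : OM 𝕜) : ℝ → 𝕜) =
        (((compOp 𝕜 ψ)^[n] f : OM 𝕜) : ℝ → 𝕜) ∘ ψ := rfl
    rw [h, ih]
    rfl

theorem OM.exists_test_mem_of_isOpen {U : Set (OM 𝕜)} (hU : IsOpen U) (hne : U.Nonempty) :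
    ∃ f ∈ U, HasCompactSupport (f : ℝ → 𝕜) := by
  obtain ⟨f, hf⟩ := hne
  let u : ℕ → OM 𝕜 := fun R => ⟨truncate (f : ℝ → 𝕜) R,
    mem_omSubmodule_of_growthBound (contDiff_truncate f.contDiff R) fun m =>
      ⟨0, exists_growthBound_of_hasCompactSupport (contDiff_truncate f.contDiff R)
        (hasCompactSupport_truncate _ R) m⟩⟩
  have hu : Tendsto u atTop (𝓝 f) := OM.tendsto_of_stepwiseNull (stepwiseNull_truncate_sub f)
  obtain ⟨R, hR⟩ := (hu.eventually (hU.mem_nhds hf)).exists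
  exact ⟨u R, hR, hasCompactSupport_truncate _ R⟩

end Dynamics

end SlowlyIncreasing

open SlowlyIncreasing in
theorem SlowlyIncreasing.sequentiallyHypercyclic_and_mixing_compOp {𝕜 : Type*} [RCLike 𝕜]
    (ψ : OM ℝ) (hbij : Function.Bijective ψ) {e : Equiv.Perm ℝ}
    (he : e = Equiv.ofBijective ψ hbij) (hfix : ∀ x, e x ≠ x)
    (hc : ∀ z : ℤ, ContDiff ℝ ∞ ⇑(e ^ z))
    (hb : ∀ m, ∃ k A, ∀ z : ℤ, GrowthBound m k A (deriv ⇑(e ^ z))) :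
    SequentiallyHypercyclic (compOp 𝕜 ψ) ∧ Mixing (compOp 𝕜 ψ) := by
  obtain ⟨K, hK⟩ := exists_step_test_comp_zpow (𝕜 := 𝕜) hfix hc hb
  have hiter : ∀ (n : ℕ) (f : OM 𝕜),
      (((compOp 𝕜 ψ)^[n] f : OM 𝕜) : ℝ → 𝕜) = (f : ℝ → 𝕜) ∘ ⇑(e ^ n) := fun n f => by
    rw [he]
    exact coe_compOp_iterate ψ hbij n f
  constructor
  · obtain ⟨p, cp, hp, hdense⟩ := exists_seq_dense_test 𝕜
    obtain ⟨S, n, hS⟩ := exists_orbit_approximating hfix hc hK cp hp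
    refine ⟨S, Set.eq_univ_of_forall fun f => ?_⟩
    -- Letting order, accuracy and index improve together with `R` gives one sequence that works for
    -- every `m`.
    have hl : ∀ R : ℕ, ∃ l ≥ R,
        GrowthBound R 0 (1 / (R + 1)) (p l - truncate (f : ℝ → 𝕜) R) := fun R =>
      hdense _ (contDiff_truncate f.contDiff R) (hasCompactSupport_truncate _ R) R R _
        (by positivity)
    choose l hlR hl using hl
    refine ⟨fun R => (compOp 𝕜 ψ)^[n (l R)] S, fun R => ⟨n (l R), rfl⟩,
      OM.tendsto_of_stepwiseNull ?_⟩
    have h1 : StepwiseNull fun R => (S : ℝ → 𝕜) ∘ ⇑(e ^ n (l R)) - p (l R) := by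
      refine fun m => ⟨K m, fun ε hε => ?_⟩
      have ht : Tendsto (fun R : ℕ => 2 * (1 / 2 : ℝ) ^ R) atTop (𝓝 (2 * 0)) :=
        (tendsto_pow_atTop_nhds_zero_of_lt_one (by norm_num) (by norm_num)).const_mul 2
      rw [mul_zero] at ht
      filter_upwards [eventually_ge_atTop m, ht.eventually_le_const hε] with R hm hR
      refine (hS m (l R) (hm.trans (hlR R))).mono le_rfl le_rfl (le_trans ?_ hR)
      exact mul_le_mul_of_nonneg_left
        (pow_le_pow_of_le_one (by norm_num) (by norm_num) (hlR R)) zero_le_two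
    have h2 : StepwiseNull fun R => p (l R) - truncate (f : ℝ → 𝕜) R := by
      refine fun m => ⟨0, fun ε hε => ?_⟩
      filter_upwards [eventually_ge_atTop m,
        (tendsto_one_div_add_atTop_nhds_zero_nat (𝕜 := ℝ)).eventually_le_const hε] with R hm hR
      exact (hl R).mono hm le_rfl hR
    have c1 : ∀ R, ContDiff ℝ ∞ ((S : ℝ → 𝕜) ∘ ⇑(e ^ n (l R)) - p (l R)) := fun R => by
      have := hc (n (l R))
      rw [zpow_natCast] at this
      exact (S.contDiff.comp this).sub (cp _)
    have c2 : ∀ R, ContDiff ℝ ∞ (p (l R) - truncate (f : ℝ → 𝕜) R) := fun R =>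
      (cp _).sub (contDiff_truncate f.contDiff R)
    have h3 := (h1.add h2 c1 c2).add (stepwiseNull_truncate_sub f)
      (fun R => (c1 R).add (c2 R)) fun R => (contDiff_truncate f.contDiff R).sub f.contDiff
    simpa only [hiter, sub_add_sub_cancel] using h3
  · intro U V hU hUne hV hVne
    obtain ⟨f, hfU, hf⟩ := OM.exists_test_mem_of_isOpen hU hUne
    obtain ⟨g, hgV, hg⟩ := OM.exists_test_mem_of_isOpen hV hVne
    have hnull : ∀ h : OM 𝕜, HasCompactSupport (h : ℝ → 𝕜) → ∀ z : ℕ → ℤ,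
        (∀ n, n ≤ (z n).natAbs) → StepwiseNull fun n => (h : ℝ → 𝕜) ∘ ⇑(e ^ z n) := by
      refine fun h hh z hz m => ⟨K m, fun ε hε => ?_⟩
      obtain ⟨N, hN⟩ := (hK m h h.contDiff hh).2 ε hε
      filter_upwards [eventually_ge_atTop N] with n hn
      exact hN _ (hn.trans (hz n))
    -- A null sequence of exact preimages: the `n`-th iterate of the operator sends `w n` to `g`.
    let w : ℕ → OM 𝕜 := fun n => ⟨(g : ℝ → 𝕜) ∘ ⇑(e ^ (-(n : ℤ))),
      mem_omSubmodule_of_growthBound (g.contDiff.comp (hc _)) fun m =>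
        ⟨K m, (hK m g g.contDiff hg).1.imp fun _ hA => hA _⟩⟩
    have hw : ∀ n, (w n : ℝ → 𝕜) = (g : ℝ → 𝕜) ∘ ⇑(e ^ (-(n : ℤ))) := fun n => rfl
    have hadd : ∀ a b : OM 𝕜, ((a + b : OM 𝕜) : ℝ → 𝕜) = (a : ℝ → 𝕜) + b := fun a b => rfl
    have t1 : Tendsto (fun n => f + w n) atTop (𝓝 f) := by
      refine OM.tendsto_of_stepwiseNull ?_
      simpa only [hadd, hw, add_sub_cancel_left] using hnull g hg (fun n => -(n : ℤ)) (by simp)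
    have t2 : Tendsto (fun n => (compOp 𝕜 ψ)^[n] (f + w n)) atTop (𝓝 g) := by
      refine OM.tendsto_of_stepwiseNull ?_
      have h := hnull f hf (fun n => (n : ℤ)) (by simp)
      convert h using 2 with n
      rw [hiter, hadd, hw]
      ext x
      simp
    obtain ⟨N, hN⟩ := eventually_atTop.mp
      ((t1.eventually (hU.mem_nhds hfU)).and (t2.eventually (hV.mem_nhds hgV)))
    exact ⟨N, fun n hn => ⟨_, ⟨_, (hN n hn).1, rfl⟩, (hN n hn).2⟩⟩

theorem corollary3p2 (𝕜 : Type*) [RCLike 𝕜] (ψ : SlowlyIncreasing.OM ℝ)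
    (hbij : Function.Bijective ψ) (hderiv : ∀ x : ℝ, deriv ψ x ≠ 0) (hfix : ∀ x : ℝ, ψ x ≠ x)
    (hbdd : SlowlyIncreasing.BoundedInOM ℝ
      (Set.range fun n : ℤ => deriv (SlowlyIncreasing.zIter ψ hbij n))) :
    SlowlyIncreasing.SequentiallyHypercyclic (SlowlyIncreasing.compOp 𝕜 ψ) ∧
      SlowlyIncreasing.Mixing (SlowlyIncreasing.compOp 𝕜 ψ) := by
  obtain ⟨B, hB, hBS⟩ := hbdd
  have hcont : Continuous (Equiv.ofBijective ψ hbij) := ψ.contDiff.continuous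
  refine SlowlyIncreasing.sequentiallyHypercyclic_and_mixing_compOp ψ hbij rfl hfix
    (SlowlyIncreasing.contDiff_perm_zpow ψ.contDiff hderiv
      (SlowlyIncreasing.continuous_perm_inv hcont)) fun m => ?_
  obtain ⟨k, A, hA⟩ := SlowlyIncreasing.exists_uniform_growthBound hB m
  refine ⟨k, A, fun z => ?_⟩
  obtain ⟨g, hg, hgz⟩ := hBS.ge ⟨z, rfl⟩
  have h := hA g hg
  rw [show (g : ℝ → ℝ) = _ from hgz] at h
  exact h
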